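/- Let $n,r\ge 0$ and let $M$ be a loopfree matroid of rank $r$ on $[n]=\{1,\dots,n\}$. Definitions. The cyclic part of a flat $F$ of a matroid is the union of all circuits contained in $F$; a flat is cyclic if it equals its cyclic part. Let $\mathcal Z(M)$ be the set of cyclic flats of $M$ and let $1_{\mathcal Z}\in\mathcal Z(M)$ be the union of all circuits of $M$, which is the largest cyclic flat. The cyclic chain lattice of $M$ is $$\mathcal C_{\mathcal Z}(M)=\{T\subseteq\mathcal Z(M)\ :\ T\text{ is a chain under inclusion with }\emptyset,1_{\mathcal Z}\in T\}\cup\{\hat 1\},$$ where chains are ordered by inclusion, $T\subseteq T'$, and $\hat 1$ is an artificial maximal element with $T<\hat 1$ for all chains $T$. Let $\mu$ be its Möbius function. Let $\mathbb M_{r,n}$ be the quotient of the free $\mathbb Z$-module on all loopfree matroids of rank $r$ on $[n]$ by the kernel of the homomorphism $N\mapsto v_N\in\mathbb Z^{\mathfrak C_{r,n}}$, where $\mathfrak C_{r,n}$ is the set of chains $\emptyset=F_0\subsetneq F_1\subsetneq\dots\subsetneq F_r=[n]$ of subsets of $[n]$, and the coordinate of $v_N$ at such a chain is $1$ if all $F_i$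 are flats of $N$ and $0$ otherwise. Theorem. For every $\hat 1\ne T\in\mathcal C_{\mathcal Z}(M)$ there is a unique matroid $M\langle T\rangle$ on $[n]$ whose set of cyclic flats is exactly $T$ and which satisfies $\operatorname{rank}_{M\langle T\rangle}(Z)=\operatorname{rank}_M(Z)$ for all $Z\in T$. It is a loopfree nested matroid of rank $r$, its independent sets being the $I\subseteq[n]$ with $|I\cap Z|\le\operatorname{rank}_M(Z)$ for all $Z\in T$. In $\mathbb M_{r,n}$ the following equality holds: $$M=\sum_{\substack{T\in\mathcal C_{\mathcal Z}(M)\\ T\neq\hat 1}}\bigl(-\mu(T,\hat 1)\bigr)\,M\langle T\rangle .$$ -/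

import Mathlib

open Set

noncomputable section

/-- The cyclic part of a set `F` in a matroid `M`: the union of all circuits contained in `F`. -/
def Matroid.cycPart {α : Type*} (M : Matroid α) (F : Set α) : Set α :=
  ⋃₀ {C | M.IsCircuit C ∧ C ⊆ F}

/-- A cyclic flat of `M` is a flat that equals its cyclic part. -/
def Matroid.IsCyclicFlat {α : Type*} (M : Matroid α) (Z : Set α) : Prop :=
  M.IsFlat Z ∧ M.cycPart Z = Z

/-- The set `𝒵(M)` of all cyclic flats of `M`. -/
def Matroid.cyclicFlats {α : Type*} (M : Matroid α) : Set (Set α) :=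
  {Z | M.IsCyclicFlat Z}

namespace MatroidRing

/-- Loopfree matroids of rank `r` on a fixed labeled ground set with `n` elements. -/
def LoopfreeMatroid (n r : ℕ) : Type :=
  {M : Matroid (Fin n) // M.E = univ ∧ M.Loopless ∧ M.eRank = (r : ℕ∞)}

/-- Chains `∅ = F₀ ⊊ F₁ ⊊ ⋯ ⊊ F_r = E` of subsets of the ground set. -/
structure SetChain (n r : ℕ) : Type where
  /-- the members `F₀, …, F_r` of the chain -/
  set : Fin (r + 1) → Set (Fin n)
  strictMono : StrictMono set
  first : set 0 = ∅
  last : set (Fin.last r) = univ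

open scoped Classical in
/-- The vector `v_M`: the indicator vector of the chains of length `r` all of whose members are
flats of `M`. -/
def flatVector {n r : ℕ} (M : LoopfreeMatroid n r) : SetChain n r → ℤ :=
  fun C ↦ if ∀ i, M.1.IsFlat (C.set i) then 1 else 0

/-- The homomorphism `Φ_{r,n}` from the free `ℤ`-module on all loopfree matroids of rank `r` on
`n` labeled elements to the `ℤ`-module with coordinates indexed by the chains, `M ↦ v_M`. -/
def Phi (n r : ℕ) : (LoopfreeMatroid n r →₀ ℤ) →ₗ[ℤ] (SetChain n r → ℤ) :=
  Finsupp.linearCombination ℤ flatVector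

/-- The rank `r` part `𝕄_{r,n}` of the intersection ring of matroids, as a `ℤ`-module. -/
abbrev RingPart (n r : ℕ) : Type :=
  (LoopfreeMatroid n r →₀ ℤ) ⧸ LinearMap.ker (Phi n r)

/-- The class of a loopfree matroid in `𝕄_{r,n}`. -/
def LoopfreeMatroid.toRing {n r : ℕ} (M : LoopfreeMatroid n r) : RingPart n r :=
  (LinearMap.ker (Phi n r)).mkQ (Finsupp.single M 1)

/-- Chains `T` of cyclic flats of `M` that contain `∅` and the largest cyclic flat
(the union of all circuits of `M`), partially ordered by inclusion. -/
abbrev CyclicChain {n : ℕ} (M : Matroid (Fin n)) : Type :=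
  {T : Set (Set (Fin n)) //
    T ⊆ M.cyclicFlats ∧ IsChain (· ⊆ ·) T ∧ ∅ ∈ T ∧ M.cycPart M.E ∈ T}

/-- The cyclic chain lattice of `M`: the chains of cyclic flats as above, ordered by inclusion,
with an artificial maximal element `1̂ = ⊤` adjoined. -/
abbrev CyclicChainLattice {n : ℕ} (M : Matroid (Fin n)) : Type := WithTop (CyclicChain M)

instance {n : ℕ} (M : Matroid (Fin n)) : Fintype (CyclicChain M) := Fintype.ofFinite _

instance {n : ℕ} (M : Matroid (Fin n)) : Fintype (CyclicChainLattice M) :=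
  inferInstanceAs (Fintype (Option (CyclicChain M)))

open scoped Classical in
instance {n : ℕ} (M : Matroid (Fin n)) : LocallyFiniteOrder (CyclicChainLattice M) :=
  Fintype.toLocallyFiniteOrder

open scoped Classical in
/-- `μ₁(T) = μ(T, 1̂)`, with `μ` the Möbius function of the cyclic chain lattice of `M`. -/
def muOne {n : ℕ} (M : Matroid (Fin n)) (T : CyclicChainLattice M) : ℤ :=
  IncidenceAlgebra.mu ℤ T ⊤

/-- The matroid whose independent sets are the `I` with `|I ∩ Z| ≤ rank_M(Z)` for all `Z ∈ T`. -/
def nestMatroid {n : ℕ} (M : Matroid (Fin n)) (T : CyclicChain M) : Matroid (Fin n) :=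
  (IndepMatroid.ofFinite (E := (univ : Set (Fin n))) (Set.toFinite _)
    (fun I ↦ ∀ Z ∈ T.1, (I ∩ Z).encard ≤ M.eRk Z)
    (by intro Z _; simp)
    (by
      intro I J hJ hIJ Z hZ
      exact (encard_le_encard (inter_subset_inter_left Z hIJ)).trans (hJ Z hZ))
    (by
      intro I J hI hJ hlt
      obtain ⟨Z, hZ⟩ := (Set.toFinite {Z | Z ∈ T.1 ∧ (I ∩ Z).encard = M.eRk Z}).exists_maximal
        ⟨∅, T.2.2.2.1, by simp⟩
      obtain ⟨⟨hZT, hZeq⟩, hmax⟩ := hZ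
      have h1 : ¬ J \ Z ⊆ I := by
        intro hsub
        have h2 : (J \ Z).encard ≤ (I \ Z).encard :=
          encard_le_encard (fun x hx ↦ ⟨hsub hx, hx.2⟩)
        have h3 := encard_sdiff_add_encard_inter J Z
        have h4 := encard_sdiff_add_encard_inter I Z
        have h5 : J.encard ≤ I.encard := by
          rw [← h3, ← h4, hZeq]
          exact add_le_add h2 (hJ Z hZT)
        rw [(Set.toFinite J).encard_eq_coe_toFinset_card,
          (Set.toFinite I).encard_eq_coe_toFinset_card, Nat.cast_le,
          ← ncard_eq_toFinset_card, ← ncard_eq_toFinset_card] at h5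
        omega
      obtain ⟨e, he, heI⟩ := not_subset.1 h1
      refine ⟨e, he.1, heI, fun Y hY ↦ ?_⟩
      by_cases heY : e ∈ Y
      · have hZY : Z ⊆ Y := by
          rcases T.2.2.1.total hZT hY with h | h
          · exact h
          · exact absurd (h heY) he.2
        have hne : (I ∩ Y).encard ≠ M.eRk Y := by
          intro h
          exact he.2 (hmax ⟨hY, h⟩ hZY heY)
        rw [insert_inter_of_mem heY]
        exact (encard_insert_le _ _).trans
          (Order.add_one_le_of_lt (lt_of_le_of_ne (hI Y hY) hne))
      · rw [insert_inter_of_notMem heY]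
        exact hI Y hY)
    (by intro I _; exact subset_univ I)).matroid

theorem nestMatroid_indep_iff {n : ℕ} (M : Matroid (Fin n)) (T : CyclicChain M)
    (I : Set (Fin n)) :
    (nestMatroid M T).Indep I ↔ ∀ Z ∈ T.1, (I ∩ Z).encard ≤ M.eRk Z := by
  simp [nestMatroid]

theorem nestMatroid_ground {n : ℕ} (M : Matroid (Fin n)) (T : CyclicChain M) :
    (nestMatroid M T).E = univ := rfl

theorem nestMatroid_indep_of_indep {n : ℕ} (M : Matroid (Fin n)) (T : CyclicChain M)
    {I : Set (Fin n)} (hI : M.Indep I) : (nestMatroid M T).Indep I := by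
  rw [nestMatroid_indep_iff]
  intro Z _
  exact (hI.inter_right Z).encard_le_eRk_of_subset inter_subset_right

theorem nestMatroid_eRank {n : ℕ} (M : Matroid (Fin n)) (hE : M.E = univ) (T : CyclicChain M) :
    (nestMatroid M T).eRank = M.eRank := by
  apply le_antisymm
  · obtain ⟨B, hB⟩ := (nestMatroid M T).exists_isBase
    rw [← hB.encard_eq_eRank]
    have hBi := (nestMatroid_indep_iff M T B).1 hB.indep _ T.2.2.2.2
    set U := M.cycPart M.E with hU
    obtain ⟨J, hJ⟩ := M.exists_isBasis U (by rw [hE]; exact subset_univ _)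
    have hind : M.Indep (J ∪ Uᶜ) := by
      by_contra hdep
      rw [Matroid.not_indep_iff (by rw [hE]; exact subset_univ _)] at hdep
      obtain ⟨C, hCs, hC⟩ := hdep.exists_isCircuit_subset
      have hCU : C ⊆ U := subset_sUnion_of_mem ⟨hC, hC.subset_ground⟩
      refine hC.not_indep (hJ.indep.subset fun x hx ↦ ?_)
      rcases hCs hx with h | h
      · exact h
      · exact absurd (hCU hx) h
    calc B.encard = (B \ U).encard + (B ∩ U).encard := (encard_sdiff_add_encard_inter B U).symm
      _ ≤ Uᶜ.encard + J.encard := by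
        refine add_le_add (encard_le_encard fun x hx ↦ hx.2) ?_
        rw [hJ.encard_eq_eRk]
        exact hBi
      _ = (J ∪ Uᶜ).encard := by
        have hdj : Disjoint J Uᶜ := disjoint_left.2 fun x hx hn ↦ hn (hJ.subset hx)
        rw [encard_union_eq hdj, add_comm]
      _ ≤ M.eRank := hind.encard_le_eRank
  · obtain ⟨B, hB⟩ := M.exists_isBase
    rw [← hB.encard_eq_eRank]
    exact (nestMatroid_indep_of_indep M T hB.indep).encard_le_eRank

theorem nestMatroid_loopless {n : ℕ} (M : Matroid (Fin n)) (hE : M.E = univ) (hM : M.Loopless)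
    (T : CyclicChain M) : (nestMatroid M T).Loopless := by
  rw [Matroid.loopless_iff_forall_isNonloop]
  intro e _
  rw [← Matroid.indep_singleton]
  apply nestMatroid_indep_of_indep
  rw [Matroid.indep_singleton]
  exact Matroid.loopless_iff_forall_isNonloop.1 hM e (by rw [hE]; exact mem_univ e)

/-- The nested matroid `M⟨T⟩` defined by a chain `T` of cyclic flats of `M`, with ranks given by
`rank_M`. -/
def LoopfreeMatroid.nest {n r : ℕ} (M : LoopfreeMatroid n r) (T : CyclicChain M.1) :
    LoopfreeMatroid n r :=
  ⟨nestMatroid M.1 T, nestMatroid_ground M.1 T, nestMatroid_loopless M.1 M.2.1 M.2.2.1 T,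
    (nestMatroid_eRank M.1 M.2.1 T).trans M.2.2.2⟩

end MatroidRing

end

/-!
The two halves have different reasons.

*Uniqueness.* A circuit spans a cyclic flat whose rank is one less than the size of the circuit, so
`I` is independent iff `|I ∩ Z| ≤ rank Z` for all cyclic flats `Z`
(`Matroid.indep_iff_forall_isCyclicFlat`); a matroid is thus determined by its cyclic flats and
their ranks. Conversely, ranks in `M⟨T⟩` are at least those in `M`, with equality on `T`, which
makes every `Z ∈ T` a cyclic flat of `M⟨T⟩`; and every circuit of `M⟨T⟩` spans a member of `T`, so
that there are no other cyclic flats (`nestMatroid_cyclicFlats`).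

*The relation in the ring.* Fix a flag `F 0 ⊂ ⋯ ⊂ F r` of subsets. The set `Z` yields the bound
`rank Z + |F i \ Z|` on `rank (F i)`. Call `Z` admissible if this bound is at least `i` for all `i`,
with equality only for `Z ⊆ F i`, and tight at `i` if `Z ⊆ F i` and the bound equals `i`. In any
matroid of rank `r` the `F i` are flats iff all cyclic flats are admissible and each `i` has a tight
one (`forall_isFlat_iff`). The cyclic flats of `M⟨T⟩` are the members of `T`, with their ranks in
`M`, so the `F i` are flats of `M⟨T⟩` iff all members of `T` are admissible and every `i` has a tight
member of `T`.

* The coefficients `-μ(T, 1̂)` of the chains `T` above a given chain sum to `1`. If the `F i` are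
  flats of `M`, then the condition says that `T` contains the cyclic parts of all `F i`, so the sum
  of the coefficients is `1`.
* Otherwise, if any chain satisfies the condition, some cyclic flat is inadmissible. Group the
  chains `T` by their tight members, which form a chain `R`. By inclusion–exclusion the sum over one
  group is the signed number of chains of inadmissible cyclic flats comparable with `R`
  (`sum_neg_muOne_ge_disjoint`). The rank bound is submodular on the lattice of cyclic flats, and
  this produces an inadmissible flat comparable with `R` whose joins with the others stay
  inadmissible and comparable with `R` (`exists_apex`). The poset in question is therefore conically
  contractible, and the signed number of its chains is `0` (`sum_chains_neg_one_pow_card`).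
-/

namespace Matroid

variable {α : Type*} {M : Matroid α} {A B F X Y Z : Set α}

/-! ### Cyclic parts and the lattice of cyclic flats -/

theorem cycPart_subset (M : Matroid α) (A : Set α) : M.cycPart A ⊆ A :=
  sUnion_subset fun _ h ↦ h.2

theorem cycPart_mono (M : Matroid α) (h : A ⊆ B) : M.cycPart A ⊆ M.cycPart B :=
  sUnion_mono fun _ hC ↦ ⟨hC.1, hC.2.trans h⟩

theorem cycPart_cycPart (M : Matroid α) (A : Set α) : M.cycPart (M.cycPart A) = M.cycPart A :=
  (M.cycPart_subset _).antisymm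
    (sUnion_mono fun C hC ↦ ⟨hC.1, fun _ hx ↦ ⟨C, hC, hx⟩⟩)

theorem subset_cycPart_of_isCircuit {C : Set α} (hC : M.IsCircuit C) (h : C ⊆ A) :
    C ⊆ M.cycPart A := fun _ hx ↦ ⟨C, ⟨hC, h⟩, hx⟩

theorem mem_cycPart_iff {e : α} : e ∈ M.cycPart A ↔ e ∈ A ∧ e ∈ M.closure (A \ {e}) := by
  constructor
  · rintro ⟨C, ⟨hC, hCA⟩, heC⟩
    exact ⟨hCA heC, M.closure_subset_closure (sdiff_subset_sdiff_left hCA)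
      (hC.mem_closure_sdiff_singleton_of_mem heC)⟩
  · rintro ⟨heA, he⟩
    obtain ⟨C, hCs, hC, heC⟩ := exists_isCircuit_of_mem_closure he (by simp)
    rw [insert_sdiff_singleton, insert_eq_of_mem heA] at hCs
    exact subset_cycPart_of_isCircuit hC hCs heC

theorem IsFlat.isCyclicFlat_cycPart (hE : M.E = univ) (hF : M.IsFlat F) :
    M.IsCyclicFlat (M.cycPart F) := by
  refine ⟨isFlat_iff_closure_eq.2 (subset_antisymm (fun x hx ↦ ?_)
    (M.subset_closure _ (by rw [hE]; exact subset_univ _))), M.cycPart_cycPart F⟩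
  have hxF : x ∈ F := hF.closure ▸ M.closure_subset_closure (M.cycPart_subset F) hx
  by_contra hxn
  refine hxn (mem_cycPart_iff.2 ⟨hxF, M.closure_subset_closure ?_ hx⟩)
  exact fun y hy ↦ ⟨M.cycPart_subset F hy, fun h ↦ hxn (h ▸ hy)⟩

theorem isCyclicFlat_closure (hE : M.E = univ) (hA : M.cycPart A = A) :
    M.IsCyclicFlat (M.closure A) := by
  have hsub : A ⊆ M.closure A := M.subset_closure _ (by rw [hE]; exact subset_univ _)
  refine ⟨isFlat_closure _, (M.cycPart_subset _).antisymm fun e he ↦ ?_⟩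
  by_cases heA : e ∈ A
  · rw [← hA] at heA
    exact M.cycPart_mono hsub heA
  · exact mem_cycPart_iff.2 ⟨he, M.closure_subset_closure
      (fun y hy ↦ (⟨hsub hy, fun h ↦ heA (h ▸ hy)⟩ : y ∈ M.closure A \ {e})) he⟩

/-- The join of two cyclic flats in the lattice of cyclic flats. -/
def cfJoin (M : Matroid α) (X Y : Set α) : Set α := M.closure (X ∪ Y)

/-- The meet of two cyclic flats in the lattice of cyclic flats. -/
def cfMeet (M : Matroid α) (X Y : Set α) : Set α := M.cycPart (X ∩ Y)

theorem IsCyclicFlat.cfJoin (hE : M.E = univ) (hX : M.IsCyclicFlat X) (hY : M.IsCyclicFlat Y) :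
    M.IsCyclicFlat (M.cfJoin X Y) := by
  refine isCyclicFlat_closure hE ((M.cycPart_subset _).antisymm (union_subset ?_ ?_))
  · exact hX.2.symm.subset.trans (M.cycPart_mono subset_union_left)
  · exact hY.2.symm.subset.trans (M.cycPart_mono subset_union_right)

theorem IsCyclicFlat.cfMeet (hE : M.E = univ) (hX : M.IsCyclicFlat X) (hY : M.IsCyclicFlat Y) :
    M.IsCyclicFlat (M.cfMeet X Y) := by
  refine IsFlat.isCyclicFlat_cycPart hE ?_
  rw [isFlat_iff_closure_eq]
  refine subset_antisymm (subset_inter ?_ ?_) (M.subset_closure _ (by rw [hE]; exact subset_univ _))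
  · exact (M.closure_subset_closure inter_subset_left).trans hX.1.closure.subset
  · exact (M.closure_subset_closure inter_subset_right).trans hY.1.closure.subset

theorem subset_cfJoin_left (hE : M.E = univ) (X Y : Set α) : X ⊆ M.cfJoin X Y :=
  subset_union_left.trans (M.subset_closure _ (by rw [hE]; exact subset_univ _))

theorem subset_cfJoin_right (hE : M.E = univ) (X Y : Set α) : Y ⊆ M.cfJoin X Y :=
  subset_union_right.trans (M.subset_closure _ (by rw [hE]; exact subset_univ _))

theorem IsFlat.cfJoin_subset (hF : M.IsFlat F) (hX : X ⊆ F) (hY : Y ⊆ F) : M.cfJoin X Y ⊆ F :=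
  (M.closure_subset_closure (union_subset hX hY)).trans hF.closure.subset

theorem cfMeet_subset_right (M : Matroid α) (X Y : Set α) : M.cfMeet X Y ⊆ Y :=
  (M.cycPart_subset _).trans inter_subset_right

theorem IsCyclicFlat.subset_cfMeet (hZ : M.IsCyclicFlat Z) (hX : Z ⊆ X) (hY : Z ⊆ Y) :
    Z ⊆ M.cfMeet X Y :=
  hZ.2.symm.subset.trans (M.cycPart_mono (subset_inter hX hY))

/-! ### Rank and nullity as integers -/

/-- The rank of a set as an integer. It is the true rank only for sets of finite rank; all ground
types below are finite. -/
noncomputable def zrk (M : Matroid α) (A : Set α) : ℤ := ((M.eRk A).toNat : ℤ)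

theorem zrk_nonneg (M : Matroid α) (A : Set α) : 0 ≤ M.zrk A := Int.natCast_nonneg _

theorem zrk_closure (M : Matroid α) (A : Set α) : M.zrk (M.closure A) = M.zrk A := by
  rw [zrk, zrk, eRk_closure_eq]

theorem Indep.zrk_eq (h : M.Indep A) : M.zrk A = A.ncard := by
  rw [zrk, h.eRk_eq_encard, ncard_def]

/-- The bound `rank Z + |A \ Z|` on the rank of `A` that a set `Z` provides. -/
noncomputable def rkBound (M : Matroid α) (A Z : Set α) : ℤ := M.zrk Z + (A \ Z).ncard

/-- The nullity of a set. -/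
noncomputable def znull (M : Matroid α) (A : Set α) : ℤ := A.ncard - M.zrk A

variable [Finite α]

theorem coe_toNat_eRk (M : Matroid α) (A : Set α) : (((M.eRk A).toNat : ℕ) : ℕ∞) = M.eRk A :=
  ENat.natCast_toNat (ne_top_of_le_ne_top (Set.toFinite A).encard_lt_top.ne (M.eRk_le_encard A))

theorem eRk_eq_iff_zrk_eq {N : Matroid α} : M.eRk A = N.eRk B ↔ M.zrk A = N.zrk B := by
  rw [← coe_toNat_eRk M, ← coe_toNat_eRk N, zrk, zrk]
  norm_cast

theorem zrk_mono (M : Matroid α) (h : A ⊆ B) : M.zrk A ≤ M.zrk B := by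
  have := M.eRk_mono h
  rw [← coe_toNat_eRk M A, ← coe_toNat_eRk M B] at this
  unfold zrk
  exact_mod_cast this

theorem zrk_submod (M : Matroid α) (A B : Set α) :
    M.zrk (A ∩ B) + M.zrk (A ∪ B) ≤ M.zrk A + M.zrk B := by
  have := M.eRk_inter_add_eRk_union_le A B
  rw [← coe_toNat_eRk M A, ← coe_toNat_eRk M B, ← coe_toNat_eRk M (A ∩ B),
    ← coe_toNat_eRk M (A ∪ B)] at this
  unfold zrk
  exact_mod_cast this

theorem zrk_le_ncard (M : Matroid α) (A : Set α) : M.zrk A ≤ A.ncard := by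
  have := M.eRk_le_encard A
  rw [← coe_toNat_eRk M, ← (Set.toFinite A).cast_ncard_eq] at this
  unfold zrk
  exact_mod_cast this

theorem zrk_le_zrk_add_sdiff (M : Matroid α) (A B : Set α) :
    M.zrk A ≤ M.zrk B + (A \ B).ncard := by
  have h1 := M.zrk_submod B (A \ B)
  have h2 := M.zrk_mono (A := A) (B := B ∪ A \ B) (by simp)
  have h3 := M.zrk_nonneg (B ∩ (A \ B))
  have h4 := M.zrk_le_ncard (A \ B)
  linarith

theorem closure_eq_of_zrk_le (hAB : A ⊆ B) (h : M.zrk B ≤ M.zrk A) :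
    M.closure A = M.closure B := by
  refine (M.isRkFinite_of_finite (Set.toFinite A)).closure_eq_closure_of_subset_of_eRk_ge_eRk hAB ?_
  exact (eRk_eq_iff_zrk_eq.2 (le_antisymm h (M.zrk_mono hAB))).le

theorem IsFlat.subset_of_zrk_le (hF : M.IsFlat F) (hE : M.E = univ) (hXF : A ⊆ F) (hAB : A ⊆ B)
    (h : M.zrk B ≤ M.zrk A) : B ⊆ F := by
  have h1 := closure_eq_of_zrk_le hAB h
  have h2 := M.subset_closure B (by rw [hE]; exact subset_univ _)
  rw [← h1] at h2
  exact h2.trans ((M.closure_subset_closure hXF).trans hF.closure.subset)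

/-- The elements of `A` outside its cyclic part are coloops of the restriction to `A`. -/
theorem zrk_cycPart_add_ncard (hE : M.E = univ) (A : Set α) :
    M.zrk (M.cycPart A) + (A \ M.cycPart A).ncard = M.zrk A := by
  apply le_antisymm
  · obtain ⟨J, hJ⟩ := M.exists_isBasis (M.cycPart A) (by rw [hE]; exact subset_univ _)
    have hind : M.Indep (J ∪ A \ M.cycPart A) := by
      by_contra hdep
      rw [not_indep_iff (by rw [hE]; exact subset_univ _)] at hdep
      obtain ⟨C, hCs, hC⟩ := hdep.exists_isCircuit_subset
      have hCU : C ⊆ M.cycPart A := subset_cycPart_of_isCircuit hC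
        (hCs.trans (union_subset (hJ.subset.trans (M.cycPart_subset A)) sdiff_subset))
      exact hC.not_indep (hJ.indep.subset fun x hx ↦ (hCs hx).resolve_right fun h ↦ h.2 (hCU hx))
    have h1 : M.zrk (M.cycPart A) = J.ncard := by
      rw [← hJ.indep.zrk_eq]
      exact eRk_eq_iff_zrk_eq.1 hJ.eRk_eq_eRk.symm
    rw [h1, ← Nat.cast_add, ← ncard_union_eq
      (disjoint_left.2 fun x hx hn ↦ hn.2 (hJ.subset hx)), ← hind.zrk_eq]
    exact M.zrk_mono (union_subset (hJ.subset.trans (M.cycPart_subset A)) sdiff_subset)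
  · exact M.zrk_le_zrk_add_sdiff _ _

theorem zrk_le_rkBound (M : Matroid α) (A Z : Set α) : M.zrk A ≤ M.rkBound A Z :=
  M.zrk_le_zrk_add_sdiff A Z

/-- On cyclic flats `cfMeet` may lose elements of `X ∩ Y`, but these are coloops of `X ∩ Y`, so the
rank drops by one for each of them and `|A \ Z|` grows by at most one. -/
theorem rkBound_submod (hE : M.E = univ) (A X Y : Set α) :
    M.rkBound A (M.cfJoin X Y) + M.rkBound A (M.cfMeet X Y) ≤
      M.rkBound A X + M.rkBound A Y := by
  have h1 := zrk_cycPart_add_ncard hE (X ∩ Y)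
  have h2 := M.zrk_submod X Y
  have h3 : M.zrk (M.cfJoin X Y) = M.zrk (X ∪ Y) := M.zrk_closure _
  have h4 : (A \ M.cfJoin X Y).ncard ≤ (A \ (X ∪ Y)).ncard :=
    ncard_le_ncard (sdiff_subset_sdiff_right (M.subset_closure _ (by rw [hE]; exact subset_univ _)))
  have h5 : (A \ M.cfMeet X Y).ncard ≤
      (A \ (X ∩ Y)).ncard + ((X ∩ Y) \ M.cycPart (X ∩ Y)).ncard := by
    refine (ncard_le_ncard fun x hx ↦ ?_).trans (ncard_union_le _ _)
    by_cases h : x ∈ X ∩ Y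
    · exact Or.inr ⟨h, hx.2⟩
    · exact Or.inl ⟨hx.1, h⟩
  have h6 := ncard_inter_add_ncard_union (A \ X) (A \ Y)
  rw [← sdiff_inter_sdiff, ← sdiff_inter] at *
  unfold rkBound
  have h7 : M.zrk (M.cfMeet X Y) = M.zrk (M.cycPart (X ∩ Y)) := rfl
  zify at *
  linarith

theorem znull_mono (M : Matroid α) (h : A ⊆ B) : M.znull A ≤ M.znull B := by
  have h1 := M.zrk_le_zrk_add_sdiff B A
  have h2 := ncard_sdiff_add_ncard_of_subset h
  unfold znull
  zify at h2
  linarith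

/-- The nullity is strictly increasing on cyclic sets: removing a non-coloop keeps the rank. -/
theorem znull_lt_of_ssubset (hB : M.cycPart B = B) (h : A ⊂ B) : M.znull A < M.znull B := by
  obtain ⟨e, heB, heA⟩ := exists_of_ssubset h
  have h1 : M.znull A ≤ M.znull (B \ {e}) :=
    M.znull_mono (subset_sdiff_singleton h.subset heA)
  have h2 : e ∈ M.closure (B \ {e}) := (mem_cycPart_iff.1 (hB.symm ▸ heB)).2
  have h3 : M.zrk (B \ {e}) = M.zrk B := by
    rw [← zrk_closure, closure_sdiff_singleton_eq_closure h2, zrk_closure]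
  have h4 := ncard_sdiff_singleton_add_one heB
  unfold znull at *
  zify at h4
  linarith

theorem znull_cycPart (hE : M.E = univ) (A : Set α) : M.znull (M.cycPart A) = M.znull A := by
  have h1 := zrk_cycPart_add_ncard hE A
  have h2 := ncard_sdiff_add_ncard_of_subset (M.cycPart_subset A)
  unfold znull
  zify at h2
  linarith

theorem rkBound_of_subset (h : Z ⊆ A) : M.rkBound A Z = A.ncard - M.znull Z := by
  have h2 := ncard_sdiff_add_ncard_of_subset h
  unfold znull rkBound
  zify at h2
  linarith

/-- A circuit spans a cyclic flat whose rank is smaller than the size of the circuit, so the rank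
bounds on cyclic flats exclude all circuits. -/
theorem indep_iff_forall_isCyclicFlat (hE : M.E = univ) {I : Set α} :
    M.Indep I ↔ ∀ Z, M.IsCyclicFlat Z → (I ∩ Z).encard ≤ M.eRk Z := by
  refine ⟨fun h Z _ ↦ (h.inter_right Z).encard_le_eRk_of_subset inter_subset_right, fun h ↦ ?_⟩
  by_contra hI
  rw [not_indep_iff (by rw [hE]; exact subset_univ _)] at hI
  obtain ⟨C, hCI, hC⟩ := hI.exists_isCircuit_subset
  have hcyc : M.cycPart C = C :=
    (M.cycPart_subset C).antisymm (subset_cycPart_of_isCircuit hC subset_rfl)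
  have h1 := h _ (isCyclicFlat_closure hE hcyc)
  rw [eRk_closure_eq] at h1
  have h2 : C ⊆ I ∩ M.closure C := subset_inter hCI (M.subset_closure C hC.subset_ground)
  exact absurd ((encard_le_encard h2).trans h1)
    (not_le.2 (eRk_lt_encard_of_dep_of_finite (Set.toFinite C) hC.dep))

end Matroid

namespace MatroidRing

/-! ### Cyclic flats of the nested matroids -/

section Nested

variable {n : ℕ} {M : Matroid (Fin n)}

theorem eRk_le_nestMatroid_eRk (T : CyclicChain M) (X : Set (Fin n)) :
    M.eRk X ≤ (nestMatroid M T).eRk X := by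
  obtain ⟨I, hIX, hI, hcard⟩ := Matroid.le_eRk_iff.1 (le_refl (M.eRk X))
  rw [← hcard]
  exact (nestMatroid_indep_of_indep M T hI).encard_le_eRk_of_subset hIX

theorem nestMatroid_eRk_of_mem (T : CyclicChain M) {Z : Set (Fin n)} (hZ : Z ∈ T.1) :
    (nestMatroid M T).eRk Z = M.eRk Z := by
  apply le_antisymm
  · rw [Matroid.eRk_le_iff]
    intro I hIZ hI
    have := (nestMatroid_indep_iff M T I).1 hI Z hZ
    rwa [inter_eq_left.2 hIZ] at this
  · exact eRk_le_nestMatroid_eRk T Z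

/-- The cyclic flats of `M` in `T` stay cyclic flats: ranks in `M⟨T⟩` are at least those in `M`,
with equality on the members of `T`. -/
theorem nestMatroid_isCyclicFlat_of_mem (hE : M.E = univ) (T : CyclicChain M) {Z : Set (Fin n)}
    (hZ : Z ∈ T.1) : (nestMatroid M T).IsCyclicFlat Z := by
  have hle : ∀ X, M.zrk X ≤ (nestMatroid M T).zrk X := fun X ↦ by
    have := eRk_le_nestMatroid_eRk T X
    rw [← Matroid.coe_toNat_eRk M, ← Matroid.coe_toNat_eRk (nestMatroid M T)] at this
    unfold Matroid.zrk
    exact_mod_cast this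
  have heq : (nestMatroid M T).zrk Z = M.zrk Z :=
    Matroid.eRk_eq_iff_zrk_eq.1 (nestMatroid_eRk_of_mem T hZ)
  obtain ⟨hF, hC⟩ := T.2.1 hZ
  constructor
  · rw [Matroid.isFlat_iff_closure_eq]
    have hsub := (nestMatroid M T).subset_closure Z (subset_univ _)
    refine subset_antisymm (hF.subset_of_zrk_le hE subset_rfl hsub ?_) hsub
    rw [← heq, ← (nestMatroid M T).zrk_closure Z]
    exact hle _
  · refine ((nestMatroid M T).cycPart_subset Z).antisymm fun e he ↦ ?_
    have h1 : e ∈ M.closure (Z \ {e}) := (Matroid.mem_cycPart_iff.1 (hC.symm ▸ he)).2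
    have h2 : M.zrk (Z \ {e}) = M.zrk Z := by
      rw [← Matroid.zrk_closure, Matroid.closure_sdiff_singleton_eq_closure h1,
        Matroid.zrk_closure]
    have h3 := Matroid.closure_eq_of_zrk_le (M := nestMatroid M T) (sdiff_subset (s := Z) (t := {e}))
      (by rw [heq, ← h2]; exact hle _)
    exact Matroid.mem_cycPart_iff.2
      ⟨he, h3 ▸ (nestMatroid M T).mem_closure_of_mem he (subset_univ _)⟩

/-- A circuit of `M⟨T⟩` violates the rank bound of some `Z ∈ T`, and then spans `Z`; so a cyclic
flat of `M⟨T⟩` is a union of members of the chain `T`. -/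
theorem nestMatroid_cyclicFlats (hE : M.E = univ) (T : CyclicChain M) :
    (nestMatroid M T).cyclicFlats = T.1 := by
  refine subset_antisymm (fun X hX ↦ ?_) fun Z hZ ↦ nestMatroid_isCyclicFlat_of_mem hE T hZ
  have key : ∀ C, (nestMatroid M T).IsCircuit C → C ⊆ X → ∃ Z ∈ T.1, C ⊆ Z ∧ Z ⊆ X := by
    intro C hC hCX
    have h1 := hC.not_indep
    rw [nestMatroid_indep_iff] at h1
    push Not at h1
    obtain ⟨Z, hZ, hlt⟩ := h1
    have hCZ : C ⊆ Z := by
      refine inter_eq_left.1 (hC.eq_of_not_indep_subset ?_ inter_subset_left)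
      rw [nestMatroid_indep_iff]
      push Not
      exact ⟨Z, hZ, by rwa [inter_assoc, inter_self]⟩
    refine ⟨Z, hZ, hCZ, ?_⟩
    obtain ⟨e, he⟩ := hC.nonempty
    have hbas := hC.sdiff_singleton_isBasis he
    have h2 : (nestMatroid M T).eRk Z ≤ (nestMatroid M T).eRk C := by
      rw [nestMatroid_eRk_of_mem T hZ, hbas.eRk_eq_encard]
      rw [inter_eq_left.2 hCZ, ← encard_sdiff_singleton_add_one he] at hlt
      exact Order.le_of_lt_add_one hlt
    have h3 := ((nestMatroid M T).isRkFinite_of_finite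
      (Set.toFinite C)).closure_eq_closure_of_subset_of_eRk_ge_eRk hCZ h2
    have h4 := (nestMatroid M T).subset_closure Z (subset_univ _)
    rw [← h3] at h4
    exact h4.trans (((nestMatroid M T).closure_subset_closure hCX).trans hX.1.closure.subset)
  -- the largest member of `T` inside `X` is all of `X`
  obtain ⟨Z, ⟨hZT, hZX⟩, hmax⟩ := (Set.toFinite {Z | Z ∈ T.1 ∧ Z ⊆ X}).exists_maximal
    ⟨∅, T.2.2.2.1, empty_subset X⟩
  suffices h : X ⊆ Z by rwa [h.antisymm hZX]
  intro e he
  rw [← hX.2] at he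
  obtain ⟨C, ⟨hC, hCX⟩, heC⟩ := he
  obtain ⟨Y, hYT, hCY, hYX⟩ := key C hC hCX
  rcases T.2.2.1.total hZT hYT with h | h
  · exact hmax ⟨hYT, hYX⟩ h (hCY heC)
  · exact h (hCY heC)

theorem eq_nestMatroid_iff (hE : M.E = univ) (T : CyclicChain M) (N : Matroid (Fin n)) :
    N = nestMatroid M T ↔
      N.E = univ ∧ N.cyclicFlats = T.1 ∧ ∀ Z ∈ T.1, N.eRk Z = M.eRk Z := by
  constructor
  · rintro rfl
    exact ⟨rfl, nestMatroid_cyclicFlats hE T, fun Z hZ ↦ nestMatroid_eRk_of_mem T hZ⟩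
  · rintro ⟨hNE, hcf, hrk⟩
    refine Matroid.ext_indep hNE fun I _ ↦ ?_
    rw [nestMatroid_indep_iff, Matroid.indep_iff_forall_isCyclicFlat hNE]
    refine ⟨fun h Z hZ ↦ ?_, fun h Z hZ ↦ ?_⟩
    · rw [← hrk Z hZ]
      exact h Z (hcf.symm.subset hZ)
    · have hZT : Z ∈ T.1 := hcf.subset hZ
      rw [hrk Z hZT]
      exact h Z hZT

end Nested

/-! ### Flags of flats in terms of cyclic flats -/

section Flag

variable {α : Type*} [Finite α] {M : Matroid α} {F : ℕ → Set α} {r : ℕ}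

/-- `Z` is admissible for the flag `F` if it is compatible with every `F i`, `i ≤ r`, being a flat
of rank `i`: the rank bound coming from `Z` is at least `i`, with equality only for `Z ⊆ F i`. -/
def Admissible (M : Matroid α) (F : ℕ → Set α) (r : ℕ) (Z : Set α) : Prop :=
  ∀ i ≤ r, (i : ℤ) ≤ M.rkBound (F i) Z ∧ (M.rkBound (F i) Z = i → Z ⊆ F i)

/-- `Z` is tight at `i` if `Z ⊆ F i` and `Z` shows that `F i` has rank at most `i`; when `F i` is a
flat of rank `i`, its cyclic part is the only tight cyclic flat. -/
def Tight (M : Matroid α) (F : ℕ → Set α) (i : ℕ) (Z : Set α) : Prop :=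
  Z ⊆ F i ∧ M.rkBound (F i) Z = i

theorem Tight.znull_eq {i : ℕ} {Z : Set α} (h : Tight M F i Z) :
    M.znull Z = (F i).ncard - i := by
  have h1 := h.2
  rw [Matroid.rkBound_of_subset h.1] at h1
  linarith

/-- The ranks along a flag of `r + 1` flats increase strictly from at least `0` to at most `r`. -/
theorem zrk_eq_of_forall_isFlat (hr : M.zrk univ = r) (hF : ∀ i < r, F i ⊂ F (i + 1))
    (hE : M.E = univ) (hflat : ∀ i ≤ r, M.IsFlat (F i)) {i : ℕ} (hi : i ≤ r) :
    M.zrk (F i) = i := by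
  have key : ∀ k i, i + k ≤ r → M.zrk (F i) + k ≤ M.zrk (F (i + k)) := by
    intro k
    induction k with
    | zero => simp
    | succ k ih =>
      intro i hik
      have h1 := ih i (by omega)
      have h2 : M.zrk (F (i + k)) < M.zrk (F (i + k + 1)) := by
        have hss := hF (i + k) (by omega)
        by_contra hle
        exact hss.2 ((hflat (i + k) (by omega)).subset_of_zrk_le hE subset_rfl hss.1 (not_lt.1 hle))
      rw [← add_assoc]
      push_cast
      linarith
  have h1 := key i 0 (by omega)
  have h2 := key (r - i) i (by omega)
  have h3 := M.zrk_nonneg (F 0)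
  have h4 := M.zrk_mono (subset_univ (F (i + (r - i))))
  rw [zero_add] at h1
  push_cast [hi] at h2
  linarith

theorem admissible_of_forall_isFlat (hr : M.zrk univ = r) (hF : ∀ i < r, F i ⊂ F (i + 1))
    (hE : M.E = univ) (hflat : ∀ i ≤ r, M.IsFlat (F i)) (Z : Set α) : Admissible M F r Z := by
  intro i hi
  have h1 := zrk_eq_of_forall_isFlat hr hF hE hflat hi
  refine ⟨h1 ▸ M.zrk_le_rkBound (F i) Z, fun heq ↦ ?_⟩
  have h2 := M.zrk_le_zrk_add_sdiff (F i) (Z ∩ F i)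
  rw [sdiff_inter_self_eq_sdiff] at h2
  unfold Matroid.rkBound at heq
  exact (hflat i hi).subset_of_zrk_le hE inter_subset_right (inter_subset_left (s := Z)) (by linarith)

theorem tight_cycPart_of_forall_isFlat (hr : M.zrk univ = r) (hF : ∀ i < r, F i ⊂ F (i + 1))
    (hE : M.E = univ) (hflat : ∀ i ≤ r, M.IsFlat (F i)) {i : ℕ} (hi : i ≤ r) :
    Tight M F i (M.cycPart (F i)) :=
  ⟨M.cycPart_subset _, (Matroid.zrk_cycPart_add_ncard hE (F i)).trans
    (zrk_eq_of_forall_isFlat hr hF hE hflat hi)⟩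

/-- A flag consists of flats exactly if all cyclic flats are admissible and each member of the flag
has a tight cyclic flat. -/
theorem forall_isFlat_iff (hr : M.zrk univ = r) (hF : ∀ i < r, F i ⊂ F (i + 1))
    (hE : M.E = univ) :
    (∀ i ≤ r, M.IsFlat (F i)) ↔
      (∀ Z ∈ M.cyclicFlats, Admissible M F r Z) ∧
        ∀ i ≤ r, ∃ Z ∈ M.cyclicFlats, Tight M F i Z := by
  constructor
  · intro hflat
    exact ⟨fun Z _ ↦ admissible_of_forall_isFlat hr hF hE hflat Z, fun i hi ↦
      ⟨_, (hflat i hi).isCyclicFlat_cycPart hE, tight_cycPart_of_forall_isFlat hr hF hE hflat hi⟩⟩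
  · rintro ⟨hadm, htight⟩ i hi
    obtain ⟨Z, -, -, hZ⟩ := htight i hi
    have h1 : M.zrk (F i) ≤ i := hZ ▸ M.zrk_le_rkBound (F i) Z
    have hsub : F i ⊆ M.closure (F i) := M.subset_closure _ (by rw [hE]; exact subset_univ _)
    -- the cyclic part `Y` of the closure bounds the rank of `F i` by at most `i`
    set G := M.closure (F i) with hG
    set Y := M.cycPart G with hY
    have h2 : M.zrk Y + (G \ Y).ncard = M.zrk (F i) := by
      rw [Matroid.zrk_cycPart_add_ncard hE, hG, M.zrk_closure]
    have h3 : (G \ Y).ncard = (F i \ Y).ncard + ((G \ F i) \ Y).ncard := by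
      rw [← ncard_union_eq (disjoint_left.2 fun x hx hx' ↦ hx'.1.2 hx.1), ← union_sdiff_distrib,
        union_sdiff_cancel hsub]
    obtain ⟨h4, h5⟩ := hadm Y ((M.isFlat_closure _).isCyclicFlat_cycPart hE) i hi
    unfold Matroid.rkBound at h4 h5
    have h6 := h5 (by zify at h3; linarith)
    have h7 : ((G \ F i) \ Y).ncard = 0 := by zify at h3 ⊢; linarith
    rw [ncard_eq_zero, sdiff_eq_empty] at h7
    rw [Matroid.isFlat_iff_closure_eq]
    refine subset_antisymm (fun x hx ↦ ?_) hsub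
    by_contra hxF
    exact hxF (h6 (h7 ⟨hx, hxF⟩))

end Flag

/-! ### Alternating sums over chains -/

open scoped Classical in
/-- The order complex of a finite poset `P` is conically contractible as soon as some `x ∈ P` has a
join in `P` with every element of `P`; hence its chains, counted with sign, cancel. -/
theorem sum_chains_neg_one_pow_card {β : Type*} [PartialOrder β] (P : Finset β) {x : β}
    (hx : x ∈ P) (j : β → β)
    (hj : ∀ y ∈ P, j y ∈ P ∧ y ≤ j y ∧ x ≤ j y ∧ ∀ z ∈ P, y ≤ z → x ≤ z → j y ≤ z) :
    ∑ B ∈ P.powerset.filter fun B : Finset β ↦ IsChain (· ≤ ·) (B : Set β),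
      (-1 : ℤ) ^ B.card = 0 := by
  -- for a chain `B`, the element `t B` to be toggled is the join of `x` with the largest member of
  -- `B` not above `x`, or `x` itself if there is none
  let D : Finset β → Finset β := fun B ↦ B.filter fun b ↦ ¬ x ≤ b
  let t : Finset β → β := fun B ↦
    if h : ∃ m ∈ D B, ∀ b ∈ D B, b ≤ m then j h.choose else x
  have ht : ∀ B ⊆ P, IsChain (· ≤ ·) (B : Set β) →
      t B ∈ P ∧ x ≤ t B ∧ ∀ b ∈ B, b ≤ t B ∨ t B ≤ b := by
    intro B hBP hB
    by_cases h : ∃ m ∈ D B, ∀ b ∈ D B, b ≤ m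
    · have htB : t B = j h.choose := dif_pos h
      obtain ⟨hm, hmax⟩ := h.choose_spec
      obtain ⟨hmB, hmx⟩ := Finset.mem_filter.1 hm
      obtain ⟨h1, h2, h3, h4⟩ := hj _ (hBP hmB)
      rw [htB]
      refine ⟨h1, h3, fun b hb ↦ ?_⟩
      by_cases hxb : x ≤ b
      · refine Or.inr (h4 b (hBP hb) ?_ hxb)
        exact (hB.total hb hmB).resolve_left fun hle ↦ hmx (hxb.trans hle)
      · exact Or.inl ((hmax b (Finset.mem_filter.2 ⟨hb, hxb⟩)).trans h2)
    · have htB : t B = x := dif_neg h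
      rw [htB]
      refine ⟨hx, le_rfl, fun b hb ↦ Or.inr ?_⟩
      by_contra hxb
      have hne : (D B).Nonempty := ⟨b, Finset.mem_filter.2 ⟨hb, hxb⟩⟩
      obtain ⟨m, hm⟩ := (D B).exists_maximal hne
      refine h ⟨m, hm.1, fun c hc ↦ ?_⟩
      rcases hB.total (Finset.mem_filter.1 hc).1 (Finset.mem_filter.1 hm.1).1 with h | h
      · exact h
      · exact hm.2 hc h
  have hD : ∀ B B' : Finset β, D B = D B' → t B = t B' := by
    intro B B' h
    simp only [t, h]
  let g : Finset β → Finset β := fun B ↦ if t B ∈ B then B.erase (t B) else insert (t B) B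
  have hg : ∀ B ⊆ P, IsChain (· ≤ ·) (B : Set β) → t (g B) = t B := by
    intro B hBP hB
    have hxt := (ht B hBP hB).2.1
    refine hD _ _ ?_
    ext b
    by_cases hmem : t B ∈ B
    · simp only [D, g, if_pos hmem, Finset.mem_filter, Finset.mem_erase]
      exact ⟨fun h ↦ ⟨h.1.2, h.2⟩, fun h ↦ ⟨⟨fun hb ↦ h.2 (hb ▸ hxt), h.1⟩, h.2⟩⟩
    · simp only [D, g, if_neg hmem, Finset.mem_filter, Finset.mem_insert]
      exact ⟨fun h ↦ ⟨h.1.resolve_left fun hb ↦ h.2 (hb ▸ hxt), h.2⟩, fun h ↦ ⟨Or.inr h.1, h.2⟩⟩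
  refine Finset.sum_involution (fun B _ ↦ g B) ?_ ?_ ?_ ?_
  · intro B _
    by_cases hmem : t B ∈ B
    · simp only [g, if_pos hmem]
      rw [← Finset.card_erase_add_one hmem]
      ring
    · simp only [g, if_neg hmem]
      rw [Finset.card_insert_of_notMem hmem]
      ring
  · intro B _ _ heq
    by_cases hmem : t B ∈ B
    · simp only [g, if_pos hmem] at heq
      exact (Finset.erase_eq_self.1 heq) hmem
    · simp only [g, if_neg hmem] at heq
      exact hmem (Finset.insert_eq_self.1 heq)
  · intro B hB
    obtain ⟨hBP, hBc⟩ := Finset.mem_filter.1 hB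
    rw [Finset.mem_powerset] at hBP
    obtain ⟨h1, -, h3⟩ := ht B hBP hBc
    rw [Finset.mem_filter, Finset.mem_powerset]
    by_cases hmem : t B ∈ B
    · simp only [g, if_pos hmem]
      exact ⟨(Finset.erase_subset _ _).trans hBP, hBc.mono (by simp)⟩
    · simp only [g, if_neg hmem]
      refine ⟨Finset.insert_subset h1 hBP, ?_⟩
      rw [Finset.coe_insert]
      exact hBc.insert fun b hb _ ↦ (h3 b hb).symm
  · intro B hB
    obtain ⟨hBP, hBc⟩ := Finset.mem_filter.1 hB
    rw [Finset.mem_powerset] at hBP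
    have h := hg B hBP hBc
    by_cases hmem : t B ∈ B
    · simp only [g, if_pos hmem] at h ⊢
      rw [h, if_neg (by simp), Finset.insert_erase hmem]
    · simp only [g, if_neg hmem] at h ⊢
      rw [h, if_pos (by simp), Finset.erase_insert hmem]

/-! ### Sums of Möbius coefficients -/

section Moebius

variable {n : ℕ} {M : Matroid (Fin n)}

open scoped Classical in
/-- The defining recursion of the Möbius function, with the term `μ(1̂, 1̂) = 1` split off. -/
theorem sum_neg_muOne_ge (U : CyclicChain M) :
    ∑ T : CyclicChain M with U ≤ T, -muOne M T = 1 := by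
  have h1 := IncidenceAlgebra.sum_Icc_mu_left (𝕜 := ℤ) (U : CyclicChainLattice M) ⊤
  rw [if_neg WithTop.coe_ne_top] at h1
  have h2 : Finset.Icc (U : CyclicChainLattice M) ⊤ =
      insert ⊤ ((Finset.univ.filter fun T : CyclicChain M ↦ U ≤ T).image
        fun T : CyclicChain M ↦ (T : CyclicChainLattice M)) := by
    ext z
    induction z with
    | top => simp
    | coe T => simp
  rw [h2, Finset.sum_insert (by simp), IncidenceAlgebra.mu_self,
    Finset.sum_image (fun a _ b _ h ↦ WithTop.coe_injective h)] at h1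
  rw [Finset.sum_neg_distrib]
  unfold muOne
  linarith

open scoped Classical in
/-- Inclusion–exclusion: the Möbius coefficients of the chains above `R` that avoid a set `V` of
cyclic flats add up to the signed number of chains in the part of `V` comparable with `R`. -/
theorem sum_neg_muOne_ge_disjoint (R : CyclicChain M) (V : Set (Set (Fin n)))
    (P : Finset (Set (Fin n)))
    (hP : ∀ X, X ∈ P ↔ X ∈ M.cyclicFlats ∧ X ∈ V ∧ ∀ Z ∈ R.1, X ⊆ Z ∨ Z ⊆ X) :
    ∑ T : CyclicChain M with R ≤ T ∧ Disjoint T.1 V, -muOne M T =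
      ∑ B ∈ P.powerset.filter fun B : Finset (Set (Fin n)) ↦
        IsChain (· ≤ ·) (B : Set (Set (Fin n))), (-1 : ℤ) ^ B.card := by
  have h1 : ∀ T : CyclicChain M, R ≤ T →
      (if Disjoint T.1 V then -muOne M T else 0) =
        ∑ B ∈ P.powerset, if (B : Set (Set (Fin n))) ⊆ T.1 then (-1 : ℤ) ^ B.card * -muOne M T
          else 0 := by
    intro T hRT
    have h2 : (P.powerset.filter fun B : Finset (Set (Fin n)) ↦ (B : Set (Set (Fin n))) ⊆ T.1) =
        (P.filter fun X ↦ X ∈ T.1).powerset := by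
      ext B
      simp only [Finset.mem_filter, Finset.mem_powerset]
      exact ⟨fun h X hX ↦ Finset.mem_filter.2 ⟨h.1 hX, h.2 hX⟩, fun h ↦
        ⟨fun X hX ↦ (Finset.mem_filter.1 (h hX)).1, fun X hX ↦ (Finset.mem_filter.1 (h hX)).2⟩⟩
    rw [← Finset.sum_filter, h2, ← Finset.sum_mul, Finset.sum_powerset_neg_one_pow_card]
    have h3 : Disjoint T.1 V ↔ (P.filter fun X ↦ X ∈ T.1) = ∅ := by
      rw [Finset.filter_eq_empty_iff, Set.disjoint_left]
      exact ⟨fun h X hX hXT ↦ h hXT ((hP X).1 hX).2.1, fun h X hXT hXV ↦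
        h ((hP X).2 ⟨T.2.1 hXT, hXV, fun Z hZ ↦ T.2.2.1.total hXT (hRT hZ)⟩) hXT⟩
    by_cases h : Disjoint T.1 V
    · rw [if_pos h, if_pos (h3.1 h), one_mul]
    · rw [if_neg h, if_neg (fun h' ↦ h (h3.2 h')), zero_mul]
  rw [← Finset.filter_filter, Finset.sum_filter,
    Finset.sum_congr rfl fun T hT ↦ h1 T (Finset.mem_filter.1 hT).2, Finset.sum_comm,
    Finset.sum_filter]
  refine Finset.sum_congr rfl fun B hB ↦ ?_
  rw [Finset.mem_powerset] at hB
  rw [← Finset.sum_filter, Finset.filter_filter, ← Finset.mul_sum]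
  by_cases hc : IsChain (· ≤ ·) (B : Set (Set (Fin n)))
  · have hU : IsChain (· ⊆ ·) (R.1 ∪ (B : Set (Set (Fin n)))) := by
      rintro X (hX | hX) Y (hY | hY) hne
      · exact R.2.2.1 hX hY hne
      · exact (((hP Y).1 (hB hY)).2.2 X hX).symm
      · exact ((hP X).1 (hB hX)).2.2 Y hY
      · exact hc hX hY hne
    let U : CyclicChain M := ⟨R.1 ∪ B, union_subset R.2.1 fun X hX ↦ ((hP X).1 (hB hX)).1, hU,
      Or.inl R.2.2.2.1, Or.inl R.2.2.2.2⟩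
    have h4 : ∀ T : CyclicChain M, (R ≤ T ∧ (B : Set (Set (Fin n))) ⊆ T.1) ↔ U ≤ T :=
      fun T ↦ union_subset_iff.symm
    simp only [h4]
    rw [sum_neg_muOne_ge U, if_pos hc, mul_one]
  · rw [if_neg hc, Finset.filter_false_of_mem, Finset.sum_empty, mul_zero]
    exact fun T _ h ↦ hc (T.2.2.1.mono h.2)

end Moebius

/-! ### Contracting the inadmissible cyclic flats -/

section Contract

variable {α : Type*} [Finite α] {M : Matroid α} {F Z : ℕ → Set α} {r : ℕ} {X Y : Set α}

theorem rkBound_succ {i : ℕ} (h : F i ⊆ F (i + 1)) (X : Set α) :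
    M.rkBound (F (i + 1)) X = M.rkBound (F i) X + ((F (i + 1) \ F i) \ X).ncard := by
  have h1 : (F (i + 1) \ X).ncard = (F i \ X).ncard + ((F (i + 1) \ F i) \ X).ncard := by
    rw [← ncard_union_eq (disjoint_left.2 fun x hx hx' ↦ hx'.1.2 hx.1), ← union_sdiff_distrib,
      union_sdiff_cancel h]
  unfold Matroid.rkBound
  rw [h1]
  push_cast
  ring

theorem Tight.le_rkBound_of_subset {i : ℕ} {W : Set α} (h : Tight M F i W) (hX : X ⊆ W) :
    (i : ℤ) ≤ M.rkBound (F i) X := by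
  rw [Matroid.rkBound_of_subset (hX.trans h.1)]
  have h1 := h.znull_eq
  have h2 := M.znull_mono hX
  linarith

theorem Tight.not_admissible {i : ℕ} {W : Set α} (h : Tight M F i W) (hi : i ≤ r)
    (hX : M.IsCyclicFlat X) (hlt : W ⊂ X) (hle : M.rkBound (F i) X ≤ i) :
    ¬ Admissible M F r X := by
  intro hadm
  obtain ⟨h1, h2⟩ := hadm i hi
  have h3 : Tight M F i X := ⟨h2 (le_antisymm hle h1), le_antisymm hle h1⟩
  have h4 := Matroid.znull_lt_of_ssubset hX.2 hlt
  rw [h.znull_eq, h3.znull_eq] at h4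
  exact lt_irrefl _ h4

/-- An inadmissible cyclic flat, joined with the tight cyclic flat at an index where admissibility
fails, still violates it there. -/
theorem exists_ssubset_rkBound_le (hE : M.E = univ) (hcyc : ∀ i ≤ r, M.IsCyclicFlat (Z i))
    (htight : ∀ i ≤ r, Tight M F i (Z i)) (hX : M.IsCyclicFlat X) (hbad : ¬ Admissible M F r X) :
    ∃ i ≤ r, ∃ Y, M.IsCyclicFlat Y ∧ Z i ⊂ Y ∧ M.rkBound (F i) Y ≤ i := by
  unfold Admissible at hbad
  push Not at hbad
  obtain ⟨i, hi, hbad⟩ := hbad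
  have hle : M.rkBound (F i) X ≤ i := by
    by_contra h
    exact (not_le.1 h).ne' (hbad (not_le.1 h).le).1
  have h1 := Matroid.rkBound_submod hE (F i) X (Z i)
  have h2 := (htight i hi).le_rkBound_of_subset (M.cfMeet_subset_right X (Z i))
  have h3 := (htight i hi).2
  refine ⟨i, hi, M.cfJoin X (Z i), hX.cfJoin hE (hcyc i hi),
    (Matroid.subset_cfJoin_right hE X (Z i)).ssubset_of_ne fun heq ↦ ?_, by linarith⟩
  have hXZ : X ⊆ Z i := heq.symm ▸ Matroid.subset_cfJoin_left hE X (Z i)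
  exact (hbad ((htight i hi).le_rkBound_of_subset hXZ)).2 (hXZ.trans (htight i hi).1)

/-- A violation above `Z i` can be pushed up to the join with `Z (i + 1)` or down to the meet with
`Z (i + 1)`, by submodularity; so one is found strictly between two consecutive tight flats. -/
theorem exists_between_rkBound_le (hE : M.E = univ) (hF : ∀ i < r, F i ⊂ F (i + 1))
    (hcyc : ∀ i ≤ r, M.IsCyclicFlat (Z i)) (htight : ∀ i ≤ r, Tight M F i (Z i))
    (hadm : ∀ i ≤ r, Admissible M F r (Z i)) (hmono : ∀ i < r, Z i ⊆ Z (i + 1))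
    (htop : ∀ X, M.IsCyclicFlat X → X ⊆ Z r) {i : ℕ} (hi : i ≤ r) (hX : M.IsCyclicFlat X)
    (hlt : Z i ⊂ X) (hle : M.rkBound (F i) X ≤ i) :
    ∃ i < r, ∃ Y, M.IsCyclicFlat Y ∧ Z i ⊂ Y ∧ Y ⊂ Z (i + 1) ∧ M.rkBound (F i) Y ≤ i := by
  induction hi using Nat.decreasingInduction generalizing X with
  | self => exact absurd (htop X hX) hlt.2
  | of_succ i hi ih =>
    have hne : ∀ Y, Z i ⊂ Y → M.rkBound (F i) Y ≤ i → Y ≠ Z (i + 1) := by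
      rintro _ h1 h2 rfl
      exact (htight i hi.le).not_admissible hi.le (hcyc (i + 1) hi) h1 h2 (hadm (i + 1) hi)
    by_cases hXZ : X ⊆ Z (i + 1)
    · exact ⟨i, hi, X, hX, hlt, hXZ.ssubset_of_ne (hne X hlt hle), hle⟩
    by_cases hmeet : M.rkBound (F i) (M.cfMeet X (Z (i + 1))) < i
    · have h1 : Z i ⊂ M.cfMeet X (Z (i + 1)) := by
        refine ((hcyc i hi.le).subset_cfMeet hlt.1 (hmono i hi)).ssubset_of_ne fun heq ↦ ?_
        rw [← heq, (htight i hi.le).2] at hmeet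
        exact lt_irrefl _ hmeet
      exact ⟨i, hi, _, hX.cfMeet hE (hcyc (i + 1) hi), h1,
        (M.cfMeet_subset_right _ _).ssubset_of_ne (hne _ h1 hmeet.le), hmeet.le⟩
    · have hsub := Matroid.subset_cfJoin_right hE X (Z (i + 1))
      refine ih (hX.cfJoin hE (hcyc (i + 1) hi)) (hsub.ssubset_of_ne fun heq ↦ hXZ ?_) ?_
      · exact heq.symm ▸ Matroid.subset_cfJoin_left hE X (Z (i + 1))
      · have h1 := Matroid.rkBound_submod hE (F i) X (Z (i + 1))
        have h2 := rkBound_succ (M := M) (hF i hi).1 (M.cfJoin X (Z (i + 1)))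
        have h3 := rkBound_succ (M := M) (hF i hi).1 (Z (i + 1))
        have h4 := (htight (i + 1) hi).2
        have h5 : ((F (i + 1) \ F i) \ M.cfJoin X (Z (i + 1))).ncard ≤
            ((F (i + 1) \ F i) \ Z (i + 1)).ncard :=
          ncard_le_ncard (sdiff_subset_sdiff_right hsub)
        zify at h5
        push_cast at h4 ⊢
        linarith

/-- Inadmissibility of a flat strictly between `Z i` and `Z (i + 1)` can be detected at `i`. -/
theorem rkBound_le_of_not_admissible (hF : ∀ i < r, F i ⊂ F (i + 1))
    (htight : ∀ i ≤ r, Tight M F i (Z i))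
    (hadm : ∀ i ≤ r, Admissible M F r (Z i)) (hmono : ∀ i j, i ≤ j → j ≤ r → Z i ⊆ Z j)
    {i : ℕ} (hi : i < r) (hZY : Z i ⊆ Y) (hYZ : Y ⊆ Z (i + 1)) (hbad : ¬ Admissible M F r Y) :
    M.rkBound (F i) Y ≤ i := by
  unfold Admissible at hbad
  push Not at hbad
  obtain ⟨k, hk, hbad⟩ := hbad
  have hle : M.rkBound (F k) Y ≤ k := by
    by_contra h
    exact (not_le.1 h).ne' (hbad (not_le.1 h).le).1
  -- for `i < k` the set `Y` lies in the tight flat `Z k`, and no subset of it fails at `k`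
  have hki : k ≤ i := by
    by_contra h
    have hYk : Y ⊆ Z k := hYZ.trans (hmono _ _ (by omega) hk)
    exact (hbad ((htight k hk).le_rkBound_of_subset hYk)).2 (hYk.trans (htight k hk).1)
  clear hbad
  -- the bound grows by at most one from `F j` to `F (j + 1)`: at most one new element is outside
  -- `Z (j + 1) ⊆ Y`, since `Z (j + 1)` is admissible at `j` and tight at `j + 1`
  suffices h : ∀ j, k ≤ j → j ≤ i → M.rkBound (F j) Y ≤ j from h i hki le_rfl
  intro j hkj
  induction j, hkj using Nat.le_induction with
  | base => exact fun _ ↦ hle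
  | succ j hkj ih =>
    intro hji
    have h1 := ih (by omega)
    have h2 := rkBound_succ (M := M) (hF j (by omega)).1 Y
    have h3 := rkBound_succ (M := M) (hF j (by omega)).1 (Z (j + 1))
    have h4 := (htight (j + 1) (by omega)).2
    have h5 := (hadm (j + 1) (by omega) j (by omega)).1
    have h6 : ((F (j + 1) \ F j) \ Y).ncard ≤ ((F (j + 1) \ F j) \ Z (j + 1)).ncard :=
      ncard_le_ncard (sdiff_subset_sdiff_right ((hmono _ _ hji hi.le).trans hZY))
    zify at h6
    push_cast at h4 ⊢
    linarith

/-- Among the inadmissible flats in a suitable gap `Z i ⊂ Y ⊂ Z (i + 1)`, one with the least rank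
bound is the apex of a cone: joins with it stay inadmissible. -/
theorem exists_apex (hE : M.E = univ) (hF : ∀ i < r, F i ⊂ F (i + 1))
    (hcyc : ∀ i ≤ r, M.IsCyclicFlat (Z i)) (htight : ∀ i ≤ r, Tight M F i (Z i))
    (hadm : ∀ i ≤ r, Admissible M F r (Z i)) (hmono : ∀ i j, i ≤ j → j ≤ r → Z i ⊆ Z j)
    (htop : ∀ X, M.IsCyclicFlat X → X ⊆ Z r) (hX : M.IsCyclicFlat X)
    (hbad : ¬ Admissible M F r X) :
    ∃ Y, M.IsCyclicFlat Y ∧ ¬ Admissible M F r Y ∧ (∀ k ≤ r, Y ⊆ Z k ∨ Z k ⊆ Y) ∧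
      ∀ W, M.IsCyclicFlat W → ¬ Admissible M F r W → (∀ k ≤ r, W ⊆ Z k ∨ Z k ⊆ W) →
        ¬ Admissible M F r (M.cfJoin W Y) ∧
          ∀ k ≤ r, M.cfJoin W Y ⊆ Z k ∨ Z k ⊆ M.cfJoin W Y := by
  obtain ⟨i₀, hi₀, Y₀, hY₀, hlt₀, hle₀⟩ := exists_ssubset_rkBound_le hE hcyc htight hX hbad
  obtain ⟨i, hi, Y₁, hY₁⟩ := exists_between_rkBound_le hE hF hcyc htight hadm
    (fun i hi ↦ hmono _ _ (Nat.le_succ i) hi) htop hi₀ hY₀ hlt₀ hle₀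
  obtain ⟨Y, ⟨hY, hZY, hYZ, hle⟩, hmin⟩ := Set.exists_min_image
    {Y | M.IsCyclicFlat Y ∧ Z i ⊂ Y ∧ Y ⊂ Z (i + 1) ∧ M.rkBound (F i) Y ≤ i}
    (fun Y ↦ M.rkBound (F i) Y) (Set.toFinite _) ⟨Y₁, hY₁⟩
  have hcomp : ∀ W, Z i ⊆ W → W ⊆ Z (i + 1) → ∀ k ≤ r, W ⊆ Z k ∨ Z k ⊆ W := by
    intro W h1 h2 k hk
    rcases Nat.lt_or_ge i k with h | h
    · exact Or.inl (h2.trans (hmono _ _ h hk))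
    · exact Or.inr ((hmono _ _ h hi.le).trans h1)
  have hYbad := (htight i hi.le).not_admissible hi.le hY hZY hle
  refine ⟨Y, hY, hYbad, hcomp Y hZY.1 hYZ.1, fun W hW hWbad hWc ↦ ?_⟩
  have hleft := Matroid.subset_cfJoin_left hE W Y
  have hright := Matroid.subset_cfJoin_right hE W Y
  rcases hWc i hi.le with h | hZW
  · have : M.cfJoin W Y = Y := (hY.1.cfJoin_subset (h.trans hZY.1) subset_rfl).antisymm hright
    rw [this]
    exact ⟨hYbad, hcomp Y hZY.1 hYZ.1⟩
  rcases hWc (i + 1) hi with hWZ | h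
  · have hjoin : M.cfJoin W Y ⊆ Z (i + 1) := (hcyc (i + 1) hi).1.cfJoin_subset hWZ hYZ.1
    refine ⟨?_, hcomp _ (hZW.trans hleft) hjoin⟩
    have h1 := rkBound_le_of_not_admissible hF htight hadm hmono hi hZW hWZ hWbad
    have h2 := Matroid.rkBound_submod hE (F i) W Y
    -- the meet is `Z i`, with bound `i`, or competes with `Y` for the least bound in the gap
    have h3 : M.rkBound (F i) Y ≤ M.rkBound (F i) (M.cfMeet W Y) := by
      have hsub := (hcyc i hi.le).subset_cfMeet hZW hZY.1
      by_contra hlt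
      rw [not_le] at hlt
      have hne : Z i ≠ M.cfMeet W Y := by
        intro heq
        rw [← heq, (htight i hi.le).2] at hlt
        exact absurd hle (not_le.2 hlt)
      exact absurd (hmin _ ⟨hW.cfMeet hE hY, hsub.ssubset_of_ne hne,
        (M.cfMeet_subset_right W Y).trans_ssubset hYZ, by linarith⟩) (not_le.2 hlt)
    exact (htight i hi.le).not_admissible hi.le (hW.cfJoin hE hY) (hZY.trans_subset hright)
      (by linarith)
  · have : M.cfJoin W Y = W := (hW.1.cfJoin_subset subset_rfl (hYZ.1.trans h)).antisymm hleft
    rw [this]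
    exact ⟨hWbad, hWc⟩

end Contract

/-! ### The coordinates of the two sides -/

section Coordinate

variable {n r : ℕ}

/-- Tight cyclic flats at `i` have equal nullity, which is strictly increasing on cyclic flats. -/
theorem tight_unique {M : Matroid (Fin n)} {F : ℕ → Set (Fin n)} {i : ℕ} {X Y : Set (Fin n)}
    (hX : M.IsCyclicFlat X) (hY : M.IsCyclicFlat Y) (hXt : Tight M F i X) (hYt : Tight M F i Y)
    (h : X ⊆ Y ∨ Y ⊆ X) : X = Y := by
  by_contra hne
  have h1 := hXt.znull_eq
  have h2 := hYt.znull_eq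
  rcases h with h | h
  · have := Matroid.znull_lt_of_ssubset hY.2 (h.ssubset_of_ne hne)
    linarith
  · have := Matroid.znull_lt_of_ssubset hX.2 (h.ssubset_of_ne (Ne.symm hne))
    linarith

/-- The members of a chain of sets as a sequence, constant from index `r` on. -/
def SetChain.seq (C : SetChain n r) (i : ℕ) : Set (Fin n) :=
  C.set ⟨min i r, Nat.lt_succ_of_le (min_le_right i r)⟩

theorem SetChain.seq_ssubset (C : SetChain n r) {i : ℕ} (hi : i < r) :
    C.seq i ⊂ C.seq (i + 1) := by
  refine C.strictMono ?_
  rw [Fin.mk_lt_mk]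
  omega

theorem SetChain.seq_mono (C : SetChain n r) {i j : ℕ} (hij : i ≤ j) : C.seq i ⊆ C.seq j := by
  refine C.strictMono.monotone ?_
  rw [Fin.mk_le_mk]
  omega

theorem SetChain.seq_zero (C : SetChain n r) : C.seq 0 = ∅ := by
  have : C.seq 0 = C.set 0 := by
    unfold SetChain.seq
    congr 1
  rw [this, C.first]

theorem SetChain.seq_last (C : SetChain n r) : C.seq r = univ := by
  have : C.seq r = C.set (Fin.last r) := by
    unfold SetChain.seq
    congr 1
    ext
    simp
  rw [this, C.last]

theorem SetChain.forall_set_iff (C : SetChain n r) (p : Set (Fin n) → Prop) :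
    (∀ i, p (C.set i)) ↔ ∀ i ≤ r, p (C.seq i) := by
  refine ⟨fun h i _ ↦ h _, fun h i ↦ ?_⟩
  have h1 := h i (Nat.le_of_lt_succ i.2)
  have h2 : C.seq i = C.set i := by
    unfold SetChain.seq
    congr 1
    ext
    simp [Nat.le_of_lt_succ i.2]
  rwa [h2] at h1

theorem LoopfreeMatroid.zrk_univ (M : LoopfreeMatroid n r) : M.1.zrk univ = r := by
  rw [Matroid.zrk, Matroid.eRk_univ_eq, M.2.2.2, ENat.toNat_natCast]

/-- All members of `T` are admissible for the flag `C`, and every index has a tight member of `T`.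
By `forall_nest_isFlat_iff` this says that all members of `C` are flats of `M⟨T⟩`. -/
def GoodFor (M : LoopfreeMatroid n r) (C : SetChain n r) (T : CyclicChain M.1) : Prop :=
  (∀ Z ∈ T.1, Admissible M.1 C.seq r Z) ∧ ∀ i ≤ r, ∃ Z ∈ T.1, Tight M.1 C.seq i Z

/-- Admissibility and tightness of `Z ∈ T` mean the same in `M⟨T⟩` as in `M`, the ranks of `Z` being
equal. -/
theorem forall_nest_isFlat_iff (M : LoopfreeMatroid n r) (C : SetChain n r)
    (T : CyclicChain M.1) : (∀ i, (M.nest T).1.IsFlat (C.set i)) ↔ GoodFor M C T := by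
  have hrk : ∀ Z ∈ T.1, ∀ A, (M.nest T).1.rkBound A Z = M.1.rkBound A Z := by
    intro Z hZ A
    have h1 : (M.nest T).1.zrk Z = M.1.zrk Z :=
      Matroid.eRk_eq_iff_zrk_eq.1 (nestMatroid_eRk_of_mem T hZ)
    rw [Matroid.rkBound, h1, Matroid.rkBound]
  have hcf : (M.nest T).1.cyclicFlats = T.1 := nestMatroid_cyclicFlats M.2.1 T
  rw [C.forall_set_iff, forall_isFlat_iff (M.nest T).zrk_univ (fun i ↦ C.seq_ssubset)
    (M.nest T).2.1, hcf]
  refine and_congr (forall₂_congr fun Z hZ ↦ forall₂_congr fun i _ ↦ by rw [hrk Z hZ])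
    (forall₂_congr fun i _ ↦ exists_congr fun Z ↦ and_congr_right fun hZ ↦ ?_)
  unfold Tight
  rw [hrk Z hZ]

/-- Only `∅` is tight at `0` and only the largest cyclic flat is tight at `r`. -/
theorem tight_zero_last {M : LoopfreeMatroid n r} {C : SetChain n r} {Z : Set (Fin n)}
    (hZ : M.1.IsCyclicFlat Z) :
    (Tight M.1 C.seq 0 Z → Z = ∅) ∧ (Tight M.1 C.seq r Z → Z = M.1.cycPart M.1.E) := by
  constructor
  · intro h
    have := h.1
    rwa [C.seq_zero, subset_empty_iff] at this
  · intro h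
    have hsub : Z ⊆ M.1.cycPart M.1.E := by
      rw [← hZ.2]
      exact M.1.cycPart_mono hZ.1.subset_ground
    by_contra hne
    have h1 := Matroid.znull_lt_of_ssubset (M.1.cycPart_cycPart _) (hsub.ssubset_of_ne hne)
    rw [Matroid.znull_cycPart M.2.1, h.znull_eq, M.2.1, C.seq_last, Matroid.znull,
      M.zrk_univ] at h1
    exact lt_irrefl _ h1

open scoped Classical in
/-- If `C` is a flag of flats of `M`, then `GoodFor` singles out the chains containing the cyclic
parts of all members of `C`. -/
theorem sum_goodFor_of_isFlat (M : LoopfreeMatroid n r) (C : SetChain n r)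
    (h : ∀ i ≤ r, M.1.IsFlat (C.seq i)) :
    ∑ T : CyclicChain M.1 with GoodFor M C T, -muOne M.1 T = 1 := by
  have hE := M.2.1
  have hcyc : ∀ i ≤ r, M.1.IsCyclicFlat (M.1.cycPart (C.seq i)) :=
    fun i hi ↦ (h i hi).isCyclicFlat_cycPart hE
  have htight : ∀ i ≤ r, Tight M.1 C.seq i (M.1.cycPart (C.seq i)) := fun i hi ↦
    tight_cycPart_of_forall_isFlat M.zrk_univ (fun i ↦ C.seq_ssubset) hE h hi
  let U : CyclicChain M.1 := ⟨{Z | ∃ i ≤ r, M.1.cycPart (C.seq i) = Z}, by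
    rintro _ ⟨i, hi, rfl⟩
    exact hcyc i hi, by
    rintro _ ⟨i, hi, rfl⟩ _ ⟨j, hj, rfl⟩ -
    exact (le_total i j).imp (fun h ↦ M.1.cycPart_mono (C.seq_mono h))
      fun h ↦ M.1.cycPart_mono (C.seq_mono h),
    ⟨0, Nat.zero_le r, (tight_zero_last (hcyc 0 (Nat.zero_le r))).1 (htight 0 (Nat.zero_le r))⟩,
    ⟨r, le_rfl, (tight_zero_last (hcyc r le_rfl)).2 (htight r le_rfl)⟩⟩
  rw [← sum_neg_muOne_ge U]
  refine Finset.sum_congr (Finset.filter_congr fun T _ ↦ ⟨fun hT ↦ ?_, fun hT ↦ ⟨fun Z _ ↦ ?_,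
    fun i hi ↦ ⟨_, hT ⟨i, hi, rfl⟩, htight i hi⟩⟩⟩) fun _ _ ↦ rfl
  · rintro _ ⟨i, hi, rfl⟩
    obtain ⟨Z, hZ, hZt⟩ := hT.2 i hi
    have hZc : M.1.IsCyclicFlat Z := T.2.1 hZ
    have hsub : Z ⊆ M.1.cycPart (C.seq i) := by
      rw [← hZc.2]
      exact M.1.cycPart_mono hZt.1
    rwa [← tight_unique hZc (hcyc i hi) hZt (htight i hi) (Or.inl hsub)]
  · exact admissible_of_forall_isFlat M.zrk_univ (fun i ↦ C.seq_ssubset) hE h Z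

open scoped Classical in
/-- Let `R` be a chain of admissible cyclic flats, all tight somewhere, with one for every index. If
some cyclic flat is inadmissible, the coefficients of the admissible chains above `R` cancel. -/
theorem sum_ge_disjoint_eq_zero (M : LoopfreeMatroid n r) (C : SetChain n r) (R : CyclicChain M.1)
    (hR : GoodFor M C R) (hRt : ∀ Z ∈ R.1, ∃ i ≤ r, Tight M.1 C.seq i Z) {X : Set (Fin n)}
    (hX : M.1.IsCyclicFlat X) (hbad : ¬ Admissible M.1 C.seq r X) :
    ∑ T : CyclicChain M.1 with R ≤ T ∧ Disjoint T.1 {Z | ¬ Admissible M.1 C.seq r Z},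
      -muOne M.1 T = 0 := by
  have hE := M.2.1
  choose! Z hZR hZt using hR.2
  have hcyc : ∀ i ≤ r, M.1.IsCyclicFlat (Z i) := fun i hi ↦ R.2.1 (hZR i hi)
  -- if `Z j ⊂ Z i` with `i ≤ j`, then `Z i ⊆ F j` has too large a nullity to be admissible at `j`
  have hmono : ∀ i j, i ≤ j → j ≤ r → Z i ⊆ Z j := by
    intro i j hij hj
    by_contra hsub
    have hss : Z j ⊂ Z i :=
      ⟨(R.2.2.1.total (hZR i (hij.trans hj)) (hZR j hj)).resolve_left hsub, hsub⟩
    have h1 := (hR.1 _ (hZR i (hij.trans hj)) j hj).1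
    rw [Matroid.rkBound_of_subset ((hZt i (hij.trans hj)).1.trans (C.seq_mono hij))] at h1
    have h2 := (hZt j hj).znull_eq
    have h3 := Matroid.znull_lt_of_ssubset (hcyc i (hij.trans hj)).2 hss
    linarith
  have htop : ∀ X, M.1.IsCyclicFlat X → X ⊆ Z r := by
    intro X hX
    rw [(tight_zero_last (hcyc r le_rfl)).2 (hZt r le_rfl), ← hX.2]
    exact M.1.cycPart_mono hX.1.subset_ground
  obtain ⟨Y, hY, hYbad, hYcomp, hcone⟩ := exists_apex hE (fun i ↦ C.seq_ssubset) hcyc hZt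
    (fun i hi ↦ hR.1 _ (hZR i hi)) hmono htop hX hbad
  have hcomp : ∀ W, (∀ V ∈ R.1, W ⊆ V ∨ V ⊆ W) ↔ ∀ k ≤ r, W ⊆ Z k ∨ Z k ⊆ W := by
    refine fun W ↦ ⟨fun h k hk ↦ h _ (hZR k hk), fun h V hV ↦ ?_⟩
    obtain ⟨k, hk, hVt⟩ := hRt V hV
    rw [tight_unique (R.2.1 hV) (hcyc k hk) hVt (hZt k hk) (R.2.2.1.total hV (hZR k hk))]
    exact h k hk
  let P : Finset (Set (Fin n)) := Finset.univ.filter fun W ↦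
    W ∈ M.1.cyclicFlats ∧ W ∈ {Z | ¬ Admissible M.1 C.seq r Z} ∧ ∀ V ∈ R.1, W ⊆ V ∨ V ⊆ W
  have hP : ∀ W, W ∈ P ↔ W ∈ M.1.cyclicFlats ∧ W ∈ {Z | ¬ Admissible M.1 C.seq r Z} ∧
      ∀ V ∈ R.1, W ⊆ V ∨ V ⊆ W := fun W ↦ by simp [P]
  rw [sum_neg_muOne_ge_disjoint R _ P hP]
  refine sum_chains_neg_one_pow_card P ((hP Y).2 ⟨hY, hYbad, (hcomp Y).2 hYcomp⟩)
    (fun W ↦ M.1.cfJoin W Y) fun W hW ↦ ?_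
  obtain ⟨hWc, hWbad, hWcomp⟩ := (hP W).1 hW
  obtain ⟨h1, h2⟩ := hcone W hWc hWbad ((hcomp W).1 hWcomp)
  exact ⟨(hP _).2 ⟨hWc.cfJoin hE hY, h1, (hcomp _).2 h2⟩, Matroid.subset_cfJoin_left hE W Y,
    Matroid.subset_cfJoin_right hE W Y, fun V hV hWV hYV ↦
    ((hP V).1 hV).1.1.cfJoin_subset hWV hYV⟩

open scoped Classical in
/-- If `C` is not a flag of flats of `M`, the chains in `GoodFor` with a given set `R` of tight members
are the admissible chains above `R`, and each such family has coefficient sum `0`. -/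
theorem sum_goodFor_of_not_isFlat (M : LoopfreeMatroid n r) (C : SetChain n r)
    (h : ¬ ∀ i ≤ r, M.1.IsFlat (C.seq i)) :
    ∑ T : CyclicChain M.1 with GoodFor M C T, -muOne M.1 T = 0 := by
  -- group the chains by the set of their tight members
  let tightPart : CyclicChain M.1 → Set (Set (Fin n)) := fun T ↦
    {Z ∈ T.1 | ∃ i ≤ r, Tight M.1 C.seq i Z}
  rw [← Finset.sum_fiberwise _ tightPart]
  refine Finset.sum_eq_zero fun A _ ↦ ?_
  rw [Finset.filter_filter]
  by_cases hA : ∃ T₀, GoodFor M C T₀ ∧ tightPart T₀ = A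
  swap
  · rw [Finset.filter_false_of_mem fun T _ hT ↦ hA ⟨T, hT⟩, Finset.sum_empty]
  obtain ⟨T₀, hT₀, rfl⟩ := hA
  have hmem : ∀ i ≤ r, ∃ Z ∈ tightPart T₀, Tight M.1 C.seq i Z := by
    intro i hi
    obtain ⟨Z, hZ, hZt⟩ := hT₀.2 i hi
    exact ⟨Z, ⟨hZ, i, hi, hZt⟩, hZt⟩
  let R : CyclicChain M.1 := ⟨tightPart T₀, fun Z hZ ↦ T₀.2.1 hZ.1,
    T₀.2.2.1.mono fun Z hZ ↦ hZ.1, by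
      obtain ⟨Z, hZ, hZt⟩ := hmem 0 (Nat.zero_le r)
      rwa [(tight_zero_last (T₀.2.1 hZ.1)).1 hZt] at hZ, by
      obtain ⟨Z, hZ, hZt⟩ := hmem r le_rfl
      rwa [(tight_zero_last (T₀.2.1 hZ.1)).2 hZt] at hZ⟩
  have hR : GoodFor M C R := ⟨fun Z hZ ↦ hT₀.1 Z hZ.1, hmem⟩
  obtain ⟨X, hX, hbad⟩ : ∃ X, M.1.IsCyclicFlat X ∧ ¬ Admissible M.1 C.seq r X := by
    by_contra! hall
    refine h ((forall_isFlat_iff M.zrk_univ (fun i ↦ C.seq_ssubset) M.2.1).2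
      ⟨hall, fun i hi ↦ ?_⟩)
    obtain ⟨Z, hZ, hZt⟩ := hmem i hi
    exact ⟨Z, T₀.2.1 hZ.1, hZt⟩
  rw [← sum_ge_disjoint_eq_zero M C R hR (fun Z hZ ↦ hZ.2) hX hbad]
  refine Finset.sum_congr (Finset.filter_congr fun T _ ↦ ⟨?_, ?_⟩) fun _ _ ↦ rfl
  · rintro ⟨hT, hTR⟩
    refine ⟨fun Z hZ ↦ ?_, Set.disjoint_left.2 fun Z hZ hZbad ↦ hZbad (hT.1 Z hZ)⟩
    have : Z ∈ tightPart T := hTR ▸ hZ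
    exact this.1
  · rintro ⟨hRT, hdisj⟩
    refine ⟨⟨fun Z hZ ↦ not_not.1 (Set.disjoint_left.1 hdisj hZ), fun i hi ↦ ?_⟩,
      subset_antisymm ?_ fun Z hZ ↦ ⟨hRT hZ, hZ.2⟩⟩
    · obtain ⟨Z, hZ, hZt⟩ := hmem i hi
      exact ⟨Z, hRT hZ, hZt⟩
    · rintro Z ⟨hZ, i, hi, hZt⟩
      obtain ⟨Y, hY, hYt⟩ := hmem i hi
      rwa [tight_unique (T.2.1 hZ) (T₀.2.1 hY.1) hZt hYt (T.2.2.1.total hZ (hRT hY))]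

theorem flatVector_eq_sum (M : LoopfreeMatroid n r) :
    flatVector M = ∑ T : CyclicChain M.1, (-muOne M.1 T) • flatVector (M.nest T) := by
  classical
  funext C
  rw [Finset.sum_apply]
  simp only [Pi.smul_apply, smul_eq_mul, flatVector, forall_nest_isFlat_iff, mul_ite, mul_one,
    mul_zero]
  rw [← Finset.sum_filter]
  by_cases h : ∀ i ≤ r, M.1.IsFlat (C.seq i)
  · rw [if_pos ((C.forall_set_iff _).2 h), sum_goodFor_of_isFlat M C h]
  · rw [if_neg fun h' ↦ h ((C.forall_set_iff _).1 h'), sum_goodFor_of_not_isFlat M C h]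

end Coordinate

end MatroidRing

theorem mainTheorem2 {n r : ℕ} (M : MatroidRing.LoopfreeMatroid n r) :
    (∀ (T : MatroidRing.CyclicChain M.1) (N : Matroid (Fin n)),
      N = (M.nest T).1 ↔
        N.E = Set.univ ∧ N.cyclicFlats = T.1 ∧ ∀ Z ∈ T.1, N.eRk Z = M.1.eRk Z) ∧
    M.toRing =
      ∑ T : MatroidRing.CyclicChain M.1, (-MatroidRing.muOne M.1 T) • (M.nest T).toRing := by
  refine ⟨fun T N ↦ MatroidRing.eq_nestMatroid_iff M.2.1 T N, ?_⟩
  unfold MatroidRing.LoopfreeMatroid.toRing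
  simp only [← map_smul, ← map_sum]
  rw [Submodule.mkQ_apply, Submodule.mkQ_apply, Submodule.Quotient.eq, LinearMap.mem_ker, map_sub,
    map_sum, sub_eq_zero]
  simp only [map_smul, MatroidRing.Phi, Finsupp.linearCombination_single, one_smul]
  exact MatroidRing.flatVector_eq_sum M
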